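/- Let $\lambda\in\mathbb R^n$ be nonzero with $\lambda_1\ge\cdots\ge\lambda_n\ge 0$ and let $\tau>0$. For $x\in\mathbb R^n$ let $|x|^{\downarrow}$ be the vector of the absolute values of the entries of $x$ in non-increasing order, put $\kappa_\lambda(x)=\langle\lambda,|x|^{\downarrow}\rangle$, and let $\Pi_{\Delta_\tau}$ be the Euclidean projector onto $\Delta_\tau=\{x:\kappa_\lambda(x)\le\tau\}$. Let $B\in\mathbb R^{n\times n}$ be given by $Bx=(x_1-x_2,\dots,x_{n-1}-x_n,x_n)^T$, and let $C=\{x: Bx\ge 0\}=\{x:x_1\ge\cdots\ge x_n\ge 0\}$. For $w\in\mathbb R^n$ let $$x_\lambda(w)=\operatorname*{argmin}_x\{\tfrac12\|x-w\|^2 : \langle\lambda,x\rangle=\tau,\ Bx\ge 0\},$$ and let $y(w)\in\mathbb R^n$ be the multiplier of the constraint $Bx\ge0$ in the unique solution of the Lagrange dual of this problem, that is, the $z$-component of the unique minimizer $(\eta,z)$ of $\tfrac12\|w+\eta\lambda+B^Tz\|^2-\eta\tau-\tfrac12\|w\|^2$ over $\eta\in\mathbb R$, $z\in\mathbb R^n_{\ge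 0}$. For $\Gamma\subseteq\{1,\dots,n\}$ let $B_\Gamma$ consist of the rows of $B$ with index in $\Gamma$ and let $A_\Gamma=\begin{bmatrix}\lambda^T\\ B_\Gamma\end{bmatrix}$. The HS-Jacobian of $x_\lambda$ at $w$ is $$\mathcal V(w)=\{I_n-A_\Gamma^T(A_\Gamma A_\Gamma^T)^{-1}A_\Gamma : \{i:y(w)_i\ne0\}\subseteq\Gamma\subseteq\{i:(Bx_\lambda(w))_i=0\}\}.$$ For $b\in\mathbb R^n$ let $\Pi^s(b)$ be the set of signed permutation matrices $P$ with $Pb=|b|^{\downarrow}$, and let $$\mathcal S(b)=\{P^TVP : P\in\Pi^s(b),\ V\in\mathcal V(Pb)\}.$$ Then $\mathcal S$ is a nonempty and compact valued, upper semicontinuous set-valued mapping on $\mathbb R^n$, and for every $b\in\mathbb R^n$ every $S\in\mathcal S(b)$ is symmetric positive semidefinite. Moreover, every $b\in\mathbb R^n$ has a neighborhood $W$ such that $\mathcal S(b')\subseteq\mathcal S(b)$ for all $b'\in W$ and, if $\kappa_\lambda(b)>\tau$, also $$\Pi_{\Delta_\tau}(b')-\Pi_{\Delta_\tau}(b)-S(b'-b)=0\qquad\text{for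 all } b'\in W,\ S\in\mathcal S(b').$$ Consequently, if $\kappa_\lambda(b)>\tau$, then $\partial_B\Pi_{\Delta_\tau}(b)\subseteq\mathcal S(b)$, where $\partial_BF(b)$ denotes the set of all limits of Jacobians $JF(b^k)$ along sequences $b^k\to b$ of points of differentiability of $F$. -/

import Mathlib

open Filter
open scoped Matrix Topology

/-- A minimizer of `f` over `K` (an arbitrary point if there is none). All the minimization
problems below have exactly one solution. -/
noncomputable def argminOn {E : Type*} [Nonempty E] (f : E → ℝ) (K : Set E) : E :=
  Classical.epsilon fun x => x ∈ K ∧ IsMinOn f K x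

/-- The non-increasing rearrangement of the entries of `z`. -/
noncomputable def sortDesc {n : ℕ} (z : Fin n → ℝ) : Fin n → ℝ :=
  fun i => z (Tuple.sort z (Fin.rev i))

/-- The vector of the absolute values of `x`, rearranged in non-increasing order. -/
noncomputable def absSortDesc {n : ℕ} (x : Fin n → ℝ) : Fin n → ℝ :=
  sortDesc fun i => |x i|

/-- The ordered weighted `ℓ₁` norm with weights `lam`. -/
noncomputable def owlNorm {n : ℕ} (lam x : Fin n → ℝ) : ℝ :=
  ∑ i, lam i * absSortDesc x i

/-- Half the squared Euclidean distance. -/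
noncomputable def halfSqDist {n : ℕ} (b x : Fin n → ℝ) : ℝ :=
  1 / 2 * ∑ i, (x i - b i) ^ 2

/-- The Euclidean projector onto the ball `{x | owlNorm lam x ≤ τ}`. -/
noncomputable def owlProj {n : ℕ} (lam : Fin n → ℝ) (τ : ℝ) (b : Fin n → ℝ) : Fin n → ℝ :=
  argminOn (halfSqDist b) {x | owlNorm lam x ≤ τ}

/-- The monotone nonnegative cone `x₁ ≥ ⋯ ≥ xₙ ≥ 0`. -/
def monotoneCone (n : ℕ) : Set (Fin n → ℝ) :=
  {x | Antitone x ∧ ∀ i, 0 ≤ x i}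

/-- The matrix with `B x = (x₁ - x₂, …, xₙ₋₁ - xₙ, xₙ)`. -/
def diffMatrix (n : ℕ) : Matrix (Fin n) (Fin n) ℝ :=
  Matrix.of fun i j => if j = i then 1 else if j.val = i.val + 1 then -1 else 0

/-- The Euclidean projection of `w` onto `{x | ⟨lam, x⟩ = τ, x ∈ C}`, with `C` the monotone
nonnegative cone. -/
noncomputable def xLam {n : ℕ} (lam : Fin n → ℝ) (τ : ℝ) (w : Fin n → ℝ) : Fin n → ℝ :=
  argminOn (halfSqDist w) {x | lam ⬝ᵥ x = τ ∧ x ∈ monotoneCone n}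

/-- The objective (in minimization form) of the Lagrange dual of
`min {‖x - w‖² / 2 | ⟨lam, x⟩ = τ, B x ≥ 0}`, where `p.1` is the multiplier of the equation and
`p.2` the multiplier of the inequalities. -/
noncomputable def dualObjective {n : ℕ} (lam : Fin n → ℝ) (τ : ℝ) (w : Fin n → ℝ)
    (p : ℝ × (Fin n → ℝ)) : ℝ :=
  1 / 2 * ∑ i, ((w + p.1 • lam + (diffMatrix n)ᵀ *ᵥ p.2) i) ^ 2 - p.1 * τ
    - 1 / 2 * ∑ i, (w i) ^ 2

/-- The part of the dual optimal solution that belongs to the inequalities `B x ≥ 0`. -/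
noncomputable def dualMultiplier {n : ℕ} (lam : Fin n → ℝ) (τ : ℝ) (w : Fin n → ℝ) :
    Fin n → ℝ :=
  (argminOn (dualObjective lam τ w) {p | ∀ i, 0 ≤ p.2 i}).2

/-- The index sets `Γ` with `Supp (y(w)) ⊆ Γ ⊆ I(x_lam(w))`. -/
def indexFamily {n : ℕ} (lam : Fin n → ℝ) (τ : ℝ) (w : Fin n → ℝ) : Set (Finset (Fin n)) :=
  {Γ | (∀ i, dualMultiplier lam τ w i ≠ 0 → i ∈ Γ) ∧
    ∀ i ∈ Γ, (diffMatrix n *ᵥ xLam lam τ w) i = 0}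

/-- The matrix with first row `lamᵀ`, followed by the rows of `B` with index in `Γ`. -/
def stackedMatrix {n : ℕ} (lam : Fin n → ℝ) (Γ : Finset (Fin n)) :
    Matrix (Unit ⊕ Γ) (Fin n) ℝ :=
  Matrix.fromRows (Matrix.replicateRow Unit lam)
    ((diffMatrix n).submatrix (fun i : Γ => (i : Fin n)) id)

/-- The HS-Jacobian of `xLam lam τ` at `w`. -/
def hsJacobian {n : ℕ} (lam : Fin n → ℝ) (τ : ℝ) (w : Fin n → ℝ) :
    Set (Matrix (Fin n) (Fin n) ℝ) :=
  {V | ∃ Γ ∈ indexFamily lam τ w,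
    V = 1 - (stackedMatrix lam Γ)ᵀ * (stackedMatrix lam Γ * (stackedMatrix lam Γ)ᵀ)⁻¹ *
      stackedMatrix lam Γ}

/-- Signed permutation matrices. -/
def IsSignedPerm {n : ℕ} (P : Matrix (Fin n) (Fin n) ℝ) : Prop :=
  ∃ (ε : Fin n → ℝ) (σ : Equiv.Perm (Fin n)),
    (∀ i, ε i = 1 ∨ ε i = -1) ∧ P = Matrix.diagonal ε * σ.permMatrix ℝ

/-- The signed permutation matrices `P` with `P u = |u|↓`. -/
def sortingPerms {n : ℕ} (u : Fin n → ℝ) : Set (Matrix (Fin n) (Fin n) ℝ) :=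
  {P | IsSignedPerm P ∧ P *ᵥ u = absSortDesc u}

/-- The set-valued mapping `b ↦ {Pᵀ V P | P sorts b, V in the HS-Jacobian at P b}`. -/
def genJacobian {n : ℕ} (lam : Fin n → ℝ) (τ : ℝ) (b : Fin n → ℝ) :
    Set (Matrix (Fin n) (Fin n) ℝ) :=
  {S | ∃ P ∈ sortingPerms b, ∃ V ∈ hsJacobian lam τ (P *ᵥ b), S = Pᵀ * V * P}

/-- The B-subdifferential: limits of Jacobian matrices at points of differentiability that
converge to `x`. -/
def bSubdifferential {n : ℕ} (F : (Fin n → ℝ) → (Fin n → ℝ)) (x : Fin n → ℝ) :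
    Set (Matrix (Fin n) (Fin n) ℝ) :=
  {V | ∃ u : ℕ → (Fin n → ℝ), (∀ k, DifferentiableAt ℝ F (u k)) ∧ Tendsto u atTop (𝓝 x) ∧
    Tendsto (fun k => LinearMap.toMatrix' (fderiv ℝ F (u k) : (Fin n → ℝ) →ₗ[ℝ] (Fin n → ℝ)))
      atTop (𝓝 V)}

/-! The matrix `B` is invertible, so the optimality system of the sorted problem determines its
multipliers from `x`; since `x` is 1-Lipschitz in `w`, the multiplier `y` is continuous. Near `w`
nonzero entries of `y` and of `B x` stay nonzero, so the family of admissible `Γ` can only shrink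
(`eventually_indexFamily_subset`). If `Γ` is admissible at both `w` and `w'`, then `x' - x` lies in
the kernel of `A_Γ`, while `x - w` and `x' - w'` lie in the range of its transpose. Applying the
kernel projector gives the exact increment formula `xLam_sub_xLam`.

Outside the ball the multiplier of the equation is nonpositive, so the projector is `xLam`
conjugated by any sorting signed permutation (`owlProj_eq`). Permutations sorting a nearby point
also sort `b`, and the increment formula carries over. Each value of the set-valued map lies in a
fixed finite set, which gives compactness; upper semicontinuity is then the local inclusion. For the
B-subdifferential, a real vector space is not a finite union of proper subspaces, so a Jacobian
whose directional values come from finitely many matrices is one of them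
(`toMatrix_fderiv_mem_of_finite`). -/

theorem argminOn_eq {E : Type*} [Nonempty E] {f : E → ℝ} {K : Set E} {x : E} (hx : x ∈ K)
    (h : ∀ z ∈ K, f z ≤ f x → z = x) : argminOn f K = x := by
  have hmin : IsMinOn f K x := fun z hz => by
    by_contra hlt
    have hlt' : f z < f x := not_le.mp hlt
    exact hlt'.ne (congrArg f (h z hz hlt'.le))
  have hs : argminOn f K ∈ K ∧ IsMinOn f K (argminOn f K) :=
    Classical.epsilon_spec (p := fun x => x ∈ K ∧ IsMinOn f K x) ⟨x, hx, hmin⟩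
  exact h _ hs.1 (hs.2 hx)

theorem halfSqDist_eq_dotProduct {n : ℕ} (w x : Fin n → ℝ) :
    halfSqDist w x = 1 / 2 * ((x - w) ⬝ᵥ (x - w)) := by
  simp [halfSqDist, dotProduct, sq]

theorem halfSqDist_expand {n : ℕ} (w x z : Fin n → ℝ) :
    halfSqDist w z =
      halfSqDist w x + (x - w) ⬝ᵥ (z - x) + 1 / 2 * ((z - x) ⬝ᵥ (z - x)) := by
  simp only [halfSqDist_eq_dotProduct, sub_dotProduct, dotProduct_sub, dotProduct_comm w,
    dotProduct_comm z x]
  ring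

theorem dotProduct_self_nonneg' {n : ℕ} (x : Fin n → ℝ) : 0 ≤ x ⬝ᵥ x :=
  Finset.sum_nonneg fun i _ => mul_self_nonneg (x i)

theorem eq_of_sub_dotProduct_self_nonpos {n : ℕ} {x z : Fin n → ℝ}
    (h : (z - x) ⬝ᵥ (z - x) ≤ 0) : z = x :=
  sub_eq_zero.mp (dotProduct_self_eq_zero.mp (h.antisymm (dotProduct_self_nonneg' _)))

/-! ### The difference matrix and the monotone cone -/

theorem diffMatrix_mulVec_apply {n : ℕ} (x : Fin n → ℝ) (i : Fin n) :
    (diffMatrix n *ᵥ x) i = x i - if h : i.val + 1 < n then x ⟨i.val + 1, h⟩ else 0 := by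
  have h1 : ∀ j : Fin n, diffMatrix n i j * x j =
      (if j = i then x j else 0) - (if j.val = i.val + 1 then x j else 0) := by
    intro j
    by_cases h : j = i
    · subst h; simp [diffMatrix]
    · by_cases h' : j.val = i.val + 1 <;> simp [diffMatrix, h, h']
  simp only [Matrix.mulVec, dotProduct, h1, Finset.sum_sub_distrib, Finset.sum_ite_eq',
    Finset.mem_univ, if_true]
  congr 1
  split_ifs with h
  · rw [Finset.sum_eq_single ⟨i.val + 1, h⟩]
    · simp
    · intro j _ hj
      rw [if_neg fun h' => hj (Fin.ext h')]
    · simp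
  · refine Finset.sum_eq_zero fun j _ => if_neg fun h' => h ?_
    rw [← h']; exact j.isLt

/-- The inverse of `diffMatrix n`, whose columns are the generators of the monotone cone. -/
def prefixMatrix (n : ℕ) : Matrix (Fin n) (Fin n) ℝ :=
  Matrix.of fun i j => if i ≤ j then 1 else 0

theorem diffMatrix_mul_prefixMatrix (n : ℕ) : diffMatrix n * prefixMatrix n = 1 := by
  ext i k
  have h := diffMatrix_mulVec_apply (fun j => prefixMatrix n j k) i
  rw [Matrix.mul_apply]
  refine h.trans ?_
  simp only [prefixMatrix, Matrix.of_apply, Matrix.one_apply, Fin.le_def, Fin.ext_iff]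
  have := k.isLt
  split_ifs <;> first | omega | simp

theorem prefixMatrix_mul_diffMatrix (n : ℕ) : prefixMatrix n * diffMatrix n = 1 :=
  mul_eq_one_comm.mp (diffMatrix_mul_prefixMatrix n)

theorem mem_monotoneCone_iff {n : ℕ} {x : Fin n → ℝ} :
    x ∈ monotoneCone n ↔ ∀ i, 0 ≤ (diffMatrix n *ᵥ x) i := by
  constructor
  · rintro ⟨ha, hn⟩ i
    rw [diffMatrix_mulVec_apply]
    split_ifs with h
    · exact sub_nonneg.mpr (ha (Fin.le_def.mpr (Nat.le_succ _)))
    · simpa using hn i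
  · intro h
    have hx : x = prefixMatrix n *ᵥ (diffMatrix n *ᵥ x) := by
      rw [Matrix.mulVec_mulVec, prefixMatrix_mul_diffMatrix, Matrix.one_mulVec]
    generalize diffMatrix n *ᵥ x = u at h hx
    subst hx
    refine ⟨fun i j hij => ?_, fun i => ?_⟩
    · simp only [Matrix.mulVec, dotProduct]
      refine Finset.sum_le_sum fun k _ => mul_le_mul_of_nonneg_right ?_ (h k)
      simp only [prefixMatrix, Matrix.of_apply]
      split_ifs with h1 h2
      · exact le_rfl
      · exact absurd (hij.trans h1) h2
      · exact zero_le_one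
      · exact le_rfl
    · simp only [Matrix.mulVec, dotProduct]
      refine Finset.sum_nonneg fun k _ => mul_nonneg ?_ (h k)
      simp only [prefixMatrix, Matrix.of_apply]
      split_ifs
      exacts [zero_le_one, le_rfl]

theorem prefixMatrix_col_mem {n : ℕ} (k : Fin n) : (prefixMatrix n).col k ∈ monotoneCone n := by
  refine mem_monotoneCone_iff.mpr fun i => ?_
  have h : (diffMatrix n *ᵥ (prefixMatrix n).col k) i = (diffMatrix n * prefixMatrix n) i k := rfl
  rw [h, diffMatrix_mul_prefixMatrix, Matrix.one_apply]
  split_ifs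
  exacts [zero_le_one, le_rfl]

theorem monotoneCone_add_smul {n : ℕ} {x z : Fin n → ℝ} {s t : ℝ} (hx : x ∈ monotoneCone n)
    (hz : z ∈ monotoneCone n) (hs : 0 ≤ s) (ht : 0 ≤ t) : s • x + t • z ∈ monotoneCone n := by
  rw [mem_monotoneCone_iff] at *
  intro i
  rw [Matrix.mulVec_add, Matrix.mulVec_smul, Matrix.mulVec_smul]
  exact add_nonneg (mul_nonneg hs (hx i)) (mul_nonneg ht (hz i))

theorem isClosed_monotoneCone (n : ℕ) : IsClosed (monotoneCone n) := by
  have h : monotoneCone n = ⋂ i, {x | 0 ≤ (diffMatrix n *ᵥ x) i} := by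
    ext x; simp [mem_monotoneCone_iff]
  rw [h]
  refine isClosed_iInter fun i => isClosed_le continuous_const ?_
  exact (continuous_apply i).comp (Continuous.matrix_mulVec continuous_const continuous_id)

theorem pos_apply_zero_of_mem_monotoneCone {n : ℕ} {lam : Fin n → ℝ} (hlam : lam ∈ monotoneCone n)
    (hne : lam ≠ 0) (hn : 0 < n) : 0 < lam ⟨0, hn⟩ := by
  obtain ⟨i, hi⟩ := Function.ne_iff.mp hne
  exact ((hlam.2 i).lt_of_ne' hi).trans_le (hlam.1 (Fin.le_def.mpr (Nat.zero_le _)))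

theorem dotProduct_prefixMatrix_col_pos {n : ℕ} {lam : Fin n → ℝ} (hlam : lam ∈ monotoneCone n)
    (hne : lam ≠ 0) (k : Fin n) : 0 < lam ⬝ᵥ (prefixMatrix n).col k := by
  have hn : 0 < n := k.pos
  rw [dotProduct]
  refine Finset.sum_pos' (fun i _ => mul_nonneg (hlam.2 i) ((prefixMatrix_col_mem k).2 i))
    ⟨⟨0, hn⟩, Finset.mem_univ _, mul_pos (pos_apply_zero_of_mem_monotoneCone hlam hne hn) ?_⟩
  have h : (prefixMatrix n).col k ⟨0, hn⟩ = 1 := by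
    change (if (⟨0, hn⟩ : Fin n) ≤ k then (1 : ℝ) else 0) = 1
    exact if_pos (Fin.le_def.mpr (Nat.zero_le _))
  rw [h]
  exact one_pos

/-- All terms of `⟨lam, x⟩` are nonnegative, so the first one bounds the largest entry `x₁` by `τ /
lam₁`. -/
theorem isCompact_feasible {n : ℕ} {lam : Fin n → ℝ} (hlam : lam ∈ monotoneCone n)
    (hne : lam ≠ 0) (τ : ℝ) : IsCompact {x | lam ⬝ᵥ x = τ ∧ x ∈ monotoneCone n} := by
  have hn : 0 < n := by
    obtain ⟨i, -⟩ := Function.ne_iff.mp hne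
    exact i.pos
  have hpos := pos_apply_zero_of_mem_monotoneCone hlam hne hn
  refine (isCompact_Icc (a := (0 : Fin n → ℝ)) (b := fun _ => τ / lam ⟨0, hn⟩)).of_isClosed_subset
    ?_ ?_
  · exact (isClosed_eq (Continuous.dotProduct continuous_const continuous_id)
      continuous_const).inter (isClosed_monotoneCone n)
  · rintro x ⟨hx, hxC⟩
    refine ⟨hxC.2, fun i => (hxC.1 (Fin.le_def.mpr (Nat.zero_le _)) : x i ≤ x ⟨0, hn⟩).trans ?_⟩
    rw [le_div_iff₀ hpos, mul_comm, ← hx]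
    exact Finset.single_le_sum (f := fun i => lam i * x i)
      (fun i _ => mul_nonneg (hlam.2 i) (hxC.2 i)) (Finset.mem_univ _)

/-! ### Optimality system and dual multiplier -/

/-- The optimality system of `min {‖x - w‖² / 2 | ⟨lam, x⟩ = τ, B x ≥ 0}`. -/
structure IsKKT {n : ℕ} (lam : Fin n → ℝ) (τ : ℝ) (w x : Fin n → ℝ) (η : ℝ) (y : Fin n → ℝ) :
    Prop where
  mem : x ∈ monotoneCone n
  eq : lam ⬝ᵥ x = τ
  nonneg : ∀ i, 0 ≤ y i
  compl : y ⬝ᵥ (diffMatrix n *ᵥ x) = 0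
  stat : x - w = η • lam + (diffMatrix n)ᵀ *ᵥ y

theorem dotProduct_diffMatrix_nonneg {n : ℕ} {y c : Fin n → ℝ} (hy : ∀ i, 0 ≤ y i)
    (hc : c ∈ monotoneCone n) : 0 ≤ y ⬝ᵥ (diffMatrix n *ᵥ c) :=
  Finset.sum_nonneg fun i _ => mul_nonneg (hy i) (mem_monotoneCone_iff.mp hc i)

theorem smul_add_transpose_mulVec_dotProduct {n : ℕ} (lam y c : Fin n → ℝ) (η : ℝ) :
    (η • lam + (diffMatrix n)ᵀ *ᵥ y) ⬝ᵥ c = η * (lam ⬝ᵥ c) + y ⬝ᵥ (diffMatrix n *ᵥ c) := by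
  rw [add_dotProduct, smul_dotProduct, smul_eq_mul, Matrix.mulVec_transpose,
    Matrix.dotProduct_mulVec]

theorem exists_isMinOn_feasible {n : ℕ} {lam : Fin n → ℝ} (hlam : lam ∈ monotoneCone n)
    (hne : lam ≠ 0) {τ : ℝ} (hτ : 0 < τ) (w : Fin n → ℝ) :
    ∃ x ∈ {x | lam ⬝ᵥ x = τ ∧ x ∈ monotoneCone n},
      IsMinOn (halfSqDist w) {x | lam ⬝ᵥ x = τ ∧ x ∈ monotoneCone n} x := by
  refine (isCompact_feasible hlam hne τ).exists_isMinOn ?_ ?_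
  · obtain ⟨k, -⟩ := Function.ne_iff.mp hne
    have hk := dotProduct_prefixMatrix_col_pos hlam hne k
    refine ⟨(τ / (lam ⬝ᵥ (prefixMatrix n).col k)) • (prefixMatrix n).col k, ?_, ?_⟩
    · rw [dotProduct_smul, smul_eq_mul, div_mul_cancel₀ _ hk.ne']
    · simpa using monotoneCone_add_smul (prefixMatrix_col_mem k) (prefixMatrix_col_mem k)
        (div_pos hτ hk).le le_rfl
  · unfold halfSqDist
    fun_prop

theorem dotProduct_sub_nonneg_of_isMinOn {n : ℕ} {lam : Fin n → ℝ} {τ : ℝ} {w x c : Fin n → ℝ}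
    (hx : lam ⬝ᵥ x = τ ∧ x ∈ monotoneCone n)
    (hmin : IsMinOn (halfSqDist w) {x | lam ⬝ᵥ x = τ ∧ x ∈ monotoneCone n} x)
    (hc : lam ⬝ᵥ c = τ ∧ c ∈ monotoneCone n) : 0 ≤ (x - w) ⬝ᵥ (c - x) := by
  by_contra! ha
  have hb := dotProduct_self_nonneg' (c - x)
  set a := (x - w) ⬝ᵥ (c - x) with ha'
  set b := (c - x) ⬝ᵥ (c - x) with hb'
  have hd : 0 < b - a := by linarith
  -- For this `t` the objective changes by `t * a * (1 + t) / 2 < 0`. The denominator `b - a` makes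
  -- `t ≤ 1` automatic and needs no separate case `b = 0`.
  set t := -a / (b - a) with ht
  have ht0 : 0 < t := div_pos (by linarith) hd
  have ht1 : t ≤ 1 := (div_le_one hd).mpr (by linarith)
  have hz : x + t • (c - x) = (1 - t) • x + t • c := by
    rw [smul_sub, sub_smul, one_smul]; abel
  have hmem : x + t • (c - x) ∈ {x | lam ⬝ᵥ x = τ ∧ x ∈ monotoneCone n} := by
    refine ⟨?_, ?_⟩
    · rw [hz, dotProduct_add, dotProduct_smul, dotProduct_smul, hx.1, hc.1, smul_eq_mul,
        smul_eq_mul]; ring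
    · rw [hz]; exact monotoneCone_add_smul hx.2 hc.2 (by linarith) ht0.le
  have h := hmin hmem
  rw [Set.mem_ofPred_eq, halfSqDist_expand w x (x + t • (c - x)), add_sub_cancel_left, dotProduct_smul, dotProduct_smul,
    smul_dotProduct, ← ha', ← hb'] at h
  simp only [smul_eq_mul] at h
  have htb : t * (b - a) = -a := div_mul_cancel₀ _ hd.ne'
  have h2 : 0 ≤ t * (a + t * b / 2) := by linarith
  have h3 : 0 ≤ a + t * b / 2 := nonneg_of_mul_nonneg_right h2 ht0
  nlinarith

/-- No constraint qualification is needed: `η` comes from pairing stationarity with `x`, and `y`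
from inverting `B`. Nonnegativity of `y k` is the variational inequality tested at the `k`-th
generator of the cone, rescaled to be feasible. -/
theorem exists_isKKT {n : ℕ} {lam : Fin n → ℝ} (hlam : lam ∈ monotoneCone n)
    (hne : lam ≠ 0) {τ : ℝ} (hτ : 0 < τ) (w : Fin n → ℝ) : ∃ x η y, IsKKT lam τ w x η y := by
  obtain ⟨x, hx, hmin⟩ := exists_isMinOn_feasible hlam hne hτ w
  set η := ((x - w) ⬝ᵥ x) / τ with hη
  have hητ : η * τ = (x - w) ⬝ᵥ x := div_mul_cancel₀ _ hτ.ne'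
  have hstat : x - w = η • lam +
      (diffMatrix n)ᵀ *ᵥ ((prefixMatrix n)ᵀ *ᵥ (x - w - η • lam)) := by
    rw [Matrix.mulVec_mulVec, ← Matrix.transpose_mul, prefixMatrix_mul_diffMatrix,
      Matrix.transpose_one, Matrix.one_mulVec, add_sub_cancel]
  refine ⟨x, η, _, hx.2, hx.1, fun k => ?_, ?_, hstat⟩
  · have hk := dotProduct_prefixMatrix_col_pos hlam hne k
    have h1 : ((prefixMatrix n)ᵀ *ᵥ (x - w - η • lam)) k =
        (x - w) ⬝ᵥ (prefixMatrix n).col k - η * (lam ⬝ᵥ (prefixMatrix n).col k) := by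
      rw [← smul_eq_mul, ← smul_dotProduct, ← sub_dotProduct, dotProduct_comm]
      rfl
    rw [h1]
    generalize hs : lam ⬝ᵥ (prefixMatrix n).col k = s at *
    clear_value η
    have hc : lam ⬝ᵥ ((τ / s) • (prefixMatrix n).col k) = τ ∧
        (τ / s) • (prefixMatrix n).col k ∈ monotoneCone n := by
      refine ⟨?_, ?_⟩
      · rw [dotProduct_smul, smul_eq_mul, hs, div_mul_cancel₀ _ hk.ne']
      · simpa using monotoneCone_add_smul (prefixMatrix_col_mem k) (prefixMatrix_col_mem k)
          (div_pos hτ hk).le le_rfl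
    have h2 := dotProduct_sub_nonneg_of_isMinOn hx hmin hc
    rw [dotProduct_sub, dotProduct_smul, smul_eq_mul, ← hητ, sub_nonneg,
      div_mul_eq_mul_div, le_div_iff₀ hk] at h2
    nlinarith
  · have h3 := congrArg (fun v => v ⬝ᵥ x) hstat
    simp only [smul_add_transpose_mulVec_dotProduct] at h3
    rw [hx.1, hητ] at h3
    linarith

namespace IsKKT

variable {n : ℕ} {lam : Fin n → ℝ} {τ : ℝ} {w x y : Fin n → ℝ} {η : ℝ}

theorem sub_dotProduct_eq (h : IsKKT lam τ w x η y) (c : Fin n → ℝ) :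
    (x - w) ⬝ᵥ c = η * (lam ⬝ᵥ c) + y ⬝ᵥ (diffMatrix n *ᵥ c) := by
  rw [h.stat, smul_add_transpose_mulVec_dotProduct]

theorem sub_dotProduct_sub_eq (h : IsKKT lam τ w x η y) (c : Fin n → ℝ) :
    (x - w) ⬝ᵥ (c - x) = η * (lam ⬝ᵥ c - τ) + y ⬝ᵥ (diffMatrix n *ᵥ c) := by
  rw [dotProduct_sub, h.sub_dotProduct_eq, h.sub_dotProduct_eq, h.compl, h.eq]
  ring

theorem sub_dotProduct_sub_nonneg (h : IsKKT lam τ w x η y) {c : Fin n → ℝ}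
    (hc : lam ⬝ᵥ c = τ) (hcC : c ∈ monotoneCone n) : 0 ≤ (x - w) ⬝ᵥ (c - x) := by
  rw [h.sub_dotProduct_sub_eq, hc, sub_self, mul_zero, zero_add]
  exact dotProduct_diffMatrix_nonneg h.nonneg hcC

theorem multiplier_eq (h : IsKKT lam τ w x η y) (hτ : 0 < τ) : η = ((x - w) ⬝ᵥ x) / τ := by
  rw [h.sub_dotProduct_eq, h.eq, h.compl, add_zero, mul_div_cancel_right₀ _ hτ.ne']

theorem eq_prefixMatrix_mulVec (h : IsKKT lam τ w x η y) :
    y = (prefixMatrix n)ᵀ *ᵥ (x - w - η • lam) := by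
  rw [h.stat, add_sub_cancel_left, Matrix.mulVec_mulVec, ← Matrix.transpose_mul,
    diffMatrix_mul_prefixMatrix, Matrix.transpose_one, Matrix.one_mulVec]

theorem xLam_eq (h : IsKKT lam τ w x η y) : xLam lam τ w = x := by
  refine argminOn_eq ⟨h.eq, h.mem⟩ fun z hz hle => ?_
  rw [halfSqDist_expand w x z] at hle
  have := h.sub_dotProduct_sub_nonneg hz.1 hz.2
  exact eq_of_sub_dotProduct_self_nonpos (by linarith)

/-- With `v = w + ζ lam + Bᵀ z`, the dual objective at `(ζ, z)` exceeds that at `(η, y)` by `‖v -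
x‖² / 2 + ⟨z, B x⟩`. If this is not positive, `(ζ, z)` solves the optimality system with the same
`x`, which determines the multipliers. -/
theorem dualMultiplier_eq (h : IsKKT lam τ w x η y) (hτ : 0 < τ) :
    dualMultiplier lam τ w = y := by
  unfold dualMultiplier
  suffices h : argminOn (dualObjective lam τ w) {p | ∀ i, 0 ≤ p.2 i} = (η, y) by rw [h]
  refine argminOn_eq h.nonneg ?_
  rintro ⟨ζ, z⟩ hz hle
  have hz' : ∀ i, 0 ≤ z i := hz
  have hd : ∀ p : ℝ × (Fin n → ℝ), dualObjective lam τ w p = 1 / 2 *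
      ((w + (p.1 • lam + (diffMatrix n)ᵀ *ᵥ p.2)) ⬝ᵥ (w + (p.1 • lam + (diffMatrix n)ᵀ *ᵥ p.2)))
        - p.1 * τ - 1 / 2 * ∑ i, (w i) ^ 2 := by
    intro p
    rw [← add_assoc]
    simp only [dualObjective, dotProduct, sq]
  rw [hd, hd] at hle
  simp only at hle
  have hx : w + (η • lam + (diffMatrix n)ᵀ *ᵥ y) = x := by rw [← h.stat, add_sub_cancel]
  rw [hx] at hle
  set v := w + (ζ • lam + (diffMatrix n)ᵀ *ᵥ z) with hv
  have h1 : (v - x) ⬝ᵥ x = (ζ - η) * τ + z ⬝ᵥ (diffMatrix n *ᵥ x) := by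
    rw [sub_dotProduct, ← hx, hx, hv, add_dotProduct, smul_add_transpose_mulVec_dotProduct, h.eq]
    have := h.sub_dotProduct_eq x
    rw [h.eq, h.compl, sub_dotProduct] at this
    linarith
  have h2 : (v - x) ⬝ᵥ (v - x) = v ⬝ᵥ v - x ⬝ᵥ x - 2 * ((v - x) ⬝ᵥ x) := by
    simp only [sub_dotProduct, dotProduct_sub, dotProduct_comm x v]
    ring
  have h3 := dotProduct_diffMatrix_nonneg hz' h.mem
  have hvx : v = x := eq_of_sub_dotProduct_self_nonpos (by linarith)
  have hk : IsKKT lam τ w x ζ z := by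
    refine ⟨h.mem, h.eq, hz', ?_, ?_⟩
    · have h4 := dotProduct_self_nonneg' (v - x)
      rw [hvx] at hle h4 h2
      rw [hvx, sub_self, zero_dotProduct] at h1
      linarith
    · rw [← hvx, hv, add_sub_cancel_left]
  have hζ : ζ = η := by rw [h.multiplier_eq hτ, hk.multiplier_eq hτ]
  rw [Prod.mk.injEq]
  exact ⟨hζ, by rw [h.eq_prefixMatrix_mulVec, hk.eq_prefixMatrix_mulVec, hζ]⟩

end IsKKT

theorem isKKT_xLam {n : ℕ} {lam : Fin n → ℝ} (hlam : lam ∈ monotoneCone n)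
    (hne : lam ≠ 0) {τ : ℝ} (hτ : 0 < τ) (w : Fin n → ℝ) :
    IsKKT lam τ w (xLam lam τ w) (((xLam lam τ w - w) ⬝ᵥ xLam lam τ w) / τ)
      (dualMultiplier lam τ w) := by
  obtain ⟨x, η, y, h⟩ := exists_isKKT hlam hne hτ w
  rw [h.xLam_eq, h.dualMultiplier_eq hτ, ← h.multiplier_eq hτ]
  exact h

/-! ### Continuity and local behaviour of the index family -/

theorem continuous_xLam {n : ℕ} {lam : Fin n → ℝ} (hlam : lam ∈ monotoneCone n)
    (hne : lam ≠ 0) {τ : ℝ} (hτ : 0 < τ) : Continuous (xLam lam τ) := by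
  refine continuous_iff_continuousAt.mpr fun w => ?_
  refine tendsto_pi_nhds.mpr fun i => tendsto_iff_dist_tendsto_zero.mpr ?_
  have hlim : Tendsto (fun w' => √((w' - w) ⬝ᵥ (w' - w))) (𝓝 w) (𝓝 0) := by
    have hc : Continuous fun w' : Fin n → ℝ => √((w' - w) ⬝ᵥ (w' - w)) :=
      ((continuous_id.sub continuous_const).dotProduct (continuous_id.sub continuous_const)).sqrt
    simpa using hc.tendsto w
  refine squeeze_zero (fun _ => dist_nonneg) (fun w' => ?_) hlim
  have h := isKKT_xLam hlam hne hτ w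
  have h' := isKKT_xLam hlam hne hτ w'
  -- Adding the two variational inequalities gives `‖x' - x‖² ≤ ⟨w' - w, x' - x⟩`, hence
  -- nonexpansiveness.
  have h1 := h.sub_dotProduct_sub_nonneg h'.eq h'.mem
  have h2 := h'.sub_dotProduct_sub_nonneg h.eq h.mem
  generalize xLam lam τ w = x at *
  generalize xLam lam τ w' = x' at *
  have h3 := dotProduct_self_nonneg' ((w' - w) - (x' - x))
  rw [Real.dist_eq]
  refine Real.abs_le_sqrt ?_
  have h4 : (x' i - x i) ^ 2 ≤ (x' - x) ⬝ᵥ (x' - x) := by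
    rw [sq]
    exact Finset.single_le_sum (f := fun i => (x' - x) i * (x' - x) i)
      (fun i _ => mul_self_nonneg _) (Finset.mem_univ i)
  refine h4.trans ?_
  simp only [sub_dotProduct, dotProduct_sub, dotProduct_comm x' x, dotProduct_comm w' w,
    dotProduct_comm x w, dotProduct_comm x' w, dotProduct_comm x w', dotProduct_comm x' w'] at *
  linarith

theorem continuous_dualMultiplier {n : ℕ} {lam : Fin n → ℝ} (hlam : lam ∈ monotoneCone n)
    (hne : lam ≠ 0) {τ : ℝ} (hτ : 0 < τ) : Continuous (dualMultiplier lam τ) := by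
  have hx := continuous_xLam hlam hne hτ
  have h : dualMultiplier lam τ = fun w => (prefixMatrix n)ᵀ *ᵥ
      (xLam lam τ w - w - (((xLam lam τ w - w) ⬝ᵥ xLam lam τ w) / τ) • lam) :=
    funext fun w => (isKKT_xLam hlam hne hτ w).eq_prefixMatrix_mulVec
  rw [h]
  have h1 := hx.sub continuous_id
  exact continuous_const.matrix_mulVec
    (h1.sub (((h1.dotProduct hx).div_const τ).smul continuous_const))

theorem indexFamily_nonempty {n : ℕ} {lam : Fin n → ℝ} (hlam : lam ∈ monotoneCone n)
    (hne : lam ≠ 0) {τ : ℝ} (hτ : 0 < τ) (w : Fin n → ℝ) : (indexFamily lam τ w).Nonempty := by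
  classical
  have h := isKKT_xLam hlam hne hτ w
  -- The full active set works; complementarity places the support of the multiplier inside it.
  refine ⟨Finset.univ.filter fun i => (diffMatrix n *ᵥ xLam lam τ w) i = 0, fun i hi => ?_,
    fun i hi => by simpa using hi⟩
  have h1 := (Finset.sum_eq_zero_iff_of_nonneg fun i _ =>
    mul_nonneg (h.nonneg i) (mem_monotoneCone_iff.mp h.mem i)).mp h.compl i (Finset.mem_univ i)
  simpa using (mul_eq_zero.mp h1).resolve_left hi

theorem eventually_indexFamily_subset {n : ℕ} {lam : Fin n → ℝ} (hlam : lam ∈ monotoneCone n)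
    (hne : lam ≠ 0) {τ : ℝ} (hτ : 0 < τ) (w : Fin n → ℝ) :
    ∀ᶠ w' in 𝓝 w, indexFamily lam τ w' ⊆ indexFamily lam τ w := by
  have hy := continuous_dualMultiplier hlam hne hτ
  have hx : Continuous fun w => diffMatrix n *ᵥ xLam lam τ w :=
    continuous_const.matrix_mulVec (continuous_xLam hlam hne hτ)
  have h1 : ∀ᶠ w' in 𝓝 w, ∀ i, dualMultiplier lam τ w i ≠ 0 → dualMultiplier lam τ w' i ≠ 0 :=
    eventually_all.mpr fun i => eventually_imp_distrib_left.mpr fun hi =>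
      ((continuous_apply i).comp hy).continuousAt.eventually_ne hi
  have h2 : ∀ᶠ w' in 𝓝 w, ∀ i, (diffMatrix n *ᵥ xLam lam τ w) i ≠ 0 →
      (diffMatrix n *ᵥ xLam lam τ w') i ≠ 0 :=
    eventually_all.mpr fun i => eventually_imp_distrib_left.mpr fun hi =>
      ((continuous_apply i).comp hx).continuousAt.eventually_ne hi
  filter_upwards [h1, h2] with w' h1 h2 Γ hΓ
  exact ⟨fun i hi => hΓ.1 i (h1 i hi), fun i hi => by_contra fun h => h2 i h (hΓ.2 i hi)⟩

/-! ### Signed permutations, sorting, and reduction of the projector -/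

theorem IsSignedPerm.exists_mulVec_apply {n : ℕ} {P : Matrix (Fin n) (Fin n) ℝ}
    (hP : IsSignedPerm P) : ∃ (ε : Fin n → ℝ) (σ : Equiv.Perm (Fin n)),
      (∀ i, |ε i| = 1) ∧ ∀ u i, (P *ᵥ u) i = ε i * u (σ i) := by
  obtain ⟨ε, σ, hε, rfl⟩ := hP
  refine ⟨ε, σ, fun i => ?_, fun u i => ?_⟩
  · rcases hε i with h | h <;> simp [h]
  · rw [← Matrix.mulVec_mulVec, Matrix.mulVec_diagonal, Matrix.permMatrix_mulVec,
      Function.comp_apply]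

theorem IsSignedPerm.mulVec_dotProduct_mulVec {n : ℕ} {P : Matrix (Fin n) (Fin n) ℝ}
    (hP : IsSignedPerm P) (u v : Fin n → ℝ) : (P *ᵥ u) ⬝ᵥ (P *ᵥ v) = u ⬝ᵥ v := by
  obtain ⟨ε, σ, hε, h⟩ := hP.exists_mulVec_apply
  simp only [dotProduct, h]
  rw [← Equiv.sum_comp σ fun i => u i * v i]
  refine Finset.sum_congr rfl fun i _ => ?_
  rw [mul_mul_mul_comm, ← abs_mul_abs_self (ε i), hε, one_mul, one_mul]

theorem IsSignedPerm.transpose_mul_self {n : ℕ} {P : Matrix (Fin n) (Fin n) ℝ}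
    (hP : IsSignedPerm P) : Pᵀ * P = 1 := by
  refine Matrix.ext_of_mulVec_single fun i => ?_
  refine dotProduct_eq _ _ fun v => ?_
  rw [← Matrix.mulVec_mulVec, Matrix.mulVec_transpose, ← Matrix.dotProduct_mulVec,
    hP.mulVec_dotProduct_mulVec, Matrix.one_mulVec]

theorem IsSignedPerm.mul_transpose_self {n : ℕ} {P : Matrix (Fin n) (Fin n) ℝ}
    (hP : IsSignedPerm P) : P * Pᵀ = 1 :=
  mul_eq_one_comm.mp hP.transpose_mul_self

theorem setOf_isSignedPerm_finite (n : ℕ) : {P | IsSignedPerm (n := n) P}.Finite := by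
  refine (Set.finite_range fun s : (Fin n → Bool) × Equiv.Perm (Fin n) =>
    Matrix.diagonal (fun i => if s.1 i then (1 : ℝ) else -1) * s.2.permMatrix ℝ).subset ?_
  rintro P ⟨ε, σ, hε, rfl⟩
  refine ⟨(fun i => decide (ε i = 1), σ), ?_⟩
  have h : (fun i => if decide (ε i = 1) then (1 : ℝ) else -1) = ε := by
    funext i
    by_cases h : ε i = 1
    · simp [h]
    · rw [if_neg (by simpa using h), (hε i).resolve_left h]
  simp only [h]

theorem antitone_absSortDesc {n : ℕ} (u : Fin n → ℝ) : Antitone (absSortDesc u) :=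
  fun _ _ hij => Tuple.monotone_sort (fun k => |u k|) (Fin.rev_le_rev.mpr hij)

theorem absSortDesc_eq_comp {n : ℕ} (u : Fin n → ℝ) :
    absSortDesc u = (fun i => |u i|) ∘ (Fin.revPerm.trans (Tuple.sort fun i => |u i|)) :=
  rfl

theorem absSortDesc_mem_monotoneCone {n : ℕ} (u : Fin n → ℝ) : absSortDesc u ∈ monotoneCone n :=
  ⟨antitone_absSortDesc u, fun _ => abs_nonneg _⟩

theorem IsSignedPerm.absSortDesc_eq {n : ℕ} {P : Matrix (Fin n) (Fin n) ℝ} (hP : IsSignedPerm P)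
    {u : Fin n → ℝ} (hu : P *ᵥ u ∈ monotoneCone n) : absSortDesc u = P *ᵥ u := by
  obtain ⟨ε, σ, hε, h⟩ := hP.exists_mulVec_apply
  have h1 : P *ᵥ u = (fun i => |u i|) ∘ σ := by
    funext i
    rw [← abs_of_nonneg (hu.2 i), h, abs_mul, hε, one_mul, Function.comp_apply]
  have h2 := hu.1
  rw [h1] at h2 ⊢
  rw [absSortDesc_eq_comp]
  exact Tuple.unique_antitone (absSortDesc_eq_comp u ▸ antitone_absSortDesc u) h2

/-- Sorting becomes a closed linear condition on `u`, as needed in `eventually_sortingPerms_subset`.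
-/
theorem mem_sortingPerms_iff {n : ℕ} {u : Fin n → ℝ} {P : Matrix (Fin n) (Fin n) ℝ} :
    P ∈ sortingPerms u ↔ IsSignedPerm P ∧ P *ᵥ u ∈ monotoneCone n :=
  ⟨fun h => ⟨h.1, h.2 ▸ absSortDesc_mem_monotoneCone u⟩,
    fun h => ⟨h.1, (h.1.absSortDesc_eq h.2).symm⟩⟩

theorem sortingPerms_nonempty {n : ℕ} (u : Fin n → ℝ) : (sortingPerms u).Nonempty := by
  set σ : Equiv.Perm (Fin n) := Fin.revPerm.trans (Tuple.sort fun i => |u i|) with hσ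
  refine ⟨Matrix.diagonal (fun i => if 0 ≤ u (σ i) then (1 : ℝ) else -1) * σ.permMatrix ℝ,
    ⟨_, σ, fun i => ?_, rfl⟩, ?_⟩
  · split_ifs <;> simp
  · rw [absSortDesc_eq_comp, ← hσ]
    funext i
    rw [← Matrix.mulVec_mulVec, Matrix.mulVec_diagonal, Matrix.permMatrix_mulVec,
      Function.comp_apply, Function.comp_apply]
    split_ifs with h
    · rw [one_mul, abs_of_nonneg h]
    · rw [neg_one_mul, abs_of_neg (not_le.mp h)]

/-- Rearrangement inequality, after bounding each entry by its absolute value. -/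
theorem IsSignedPerm.dotProduct_mulVec_le {n : ℕ} {P : Matrix (Fin n) (Fin n) ℝ}
    (hP : IsSignedPerm P) {c : Fin n → ℝ} (hc : c ∈ monotoneCone n) (z : Fin n → ℝ) :
    c ⬝ᵥ (P *ᵥ z) ≤ c ⬝ᵥ absSortDesc z := by
  obtain ⟨ε, σ, hε, h⟩ := hP.exists_mulVec_apply
  set ρ := Fin.revPerm.trans (Tuple.sort fun i => |z i|) with hρ
  have hz : ∀ i, |z (σ i)| = absSortDesc z ((σ.trans ρ.symm) i) := fun i => by
    rw [absSortDesc_eq_comp, ← hρ]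
    simp
  refine le_trans (Finset.sum_le_sum fun i _ => ?_)
    ((hc.1.monovary (antitone_absSortDesc z)).sum_mul_comp_perm_le_sum_mul (σ := σ.trans ρ.symm))
  refine mul_le_mul_of_nonneg_left ?_ (hc.2 i)
  rw [h, ← hz]
  exact (le_abs_self _).trans (by rw [abs_mul, hε, one_mul])

theorem IsSignedPerm.halfSqDist_mulVec {n : ℕ} {P : Matrix (Fin n) (Fin n) ℝ}
    (hP : IsSignedPerm P) (b u : Fin n → ℝ) :
    halfSqDist (P *ᵥ b) (P *ᵥ u) = halfSqDist b u := by
  rw [halfSqDist_eq_dotProduct, halfSqDist_eq_dotProduct, ← Matrix.mulVec_sub,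
    hP.mulVec_dotProduct_mulVec]

theorem halfSqDist_absSortDesc_le {n : ℕ} {b : Fin n → ℝ} {P : Matrix (Fin n) (Fin n) ℝ}
    (hP : P ∈ sortingPerms b) (u : Fin n → ℝ) :
    halfSqDist (P *ᵥ b) (absSortDesc u) ≤ halfSqDist b u := by
  obtain ⟨hP, hPb⟩ := mem_sortingPerms_iff.mp hP
  obtain ⟨Q, hQ, hQu⟩ := sortingPerms_nonempty u
  have h1 := hP.dotProduct_mulVec_le hPb u
  have h2 : absSortDesc u ⬝ᵥ absSortDesc u = u ⬝ᵥ u := by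
    rw [← hQu, hQ.mulVec_dotProduct_mulVec]
  have h3 := hP.mulVec_dotProduct_mulVec b b
  rw [hP.mulVec_dotProduct_mulVec] at h1
  simp only [halfSqDist_eq_dotProduct, sub_dotProduct, dotProduct_sub, dotProduct_comm _ b,
    dotProduct_comm _ (P *ᵥ b)] at *
  linarith

/-- Convexity at the midpoint is all that uniqueness of the projection requires. The permutation
sorting the midpoint makes its norm a linear functional that the norm dominates at `u` and `v`. -/
theorem owlNorm_midpoint_le {n : ℕ} {lam : Fin n → ℝ} (hlam : lam ∈ monotoneCone n) {τ : ℝ}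
    {u v : Fin n → ℝ} (hu : owlNorm lam u ≤ τ) (hv : owlNorm lam v ≤ τ) :
    owlNorm lam (v + (1 / 2 : ℝ) • (u - v)) ≤ τ := by
  obtain ⟨Q, hQ, hQm⟩ := sortingPerms_nonempty (v + (1 / 2 : ℝ) • (u - v))
  have h1 : lam ⬝ᵥ (Q *ᵥ u) ≤ τ := (hQ.dotProduct_mulVec_le hlam u).trans hu
  have h2 : lam ⬝ᵥ (Q *ᵥ v) ≤ τ := (hQ.dotProduct_mulVec_le hlam v).trans hv
  have h3 : owlNorm lam (v + (1 / 2 : ℝ) • (u - v)) =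
      lam ⬝ᵥ (Q *ᵥ (v + (1 / 2 : ℝ) • (u - v))) := by rw [hQm]; rfl
  rw [h3, Matrix.mulVec_add, Matrix.mulVec_smul, Matrix.mulVec_sub, dotProduct_add,
    dotProduct_smul, dotProduct_sub, smul_eq_mul]
  linarith

theorem owlProj_eq {n : ℕ} {lam : Fin n → ℝ} (hlam : lam ∈ monotoneCone n)
    (hne : lam ≠ 0) {τ : ℝ} (hτ : 0 < τ) {b : Fin n → ℝ} (hb : τ < owlNorm lam b)
    {P : Matrix (Fin n) (Fin n) ℝ} (hP : P ∈ sortingPerms b) :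
    owlProj lam τ b = Pᵀ *ᵥ xLam lam τ (P *ᵥ b) := by
  have hk := isKKT_xLam hlam hne hτ (P *ᵥ b)
  obtain ⟨hPs, hPb⟩ := mem_sortingPerms_iff.mp hP
  have hw : τ < lam ⬝ᵥ (P *ᵥ b) := by rw [hP.2]; exact hb
  generalize xLam lam τ (P *ᵥ b) = x at *
  generalize (x - P *ᵥ b) ⬝ᵥ x / τ = η at *
  -- Pairing stationarity with `P b - x` gives `-‖x - P b‖² = η (⟨lam, P b⟩ - τ) + ⟨y, B P b⟩`,
  -- where the last term is nonnegative. The sign of `η` lets the equality constraint be relaxed to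
  -- `≤ τ`.
  have hη : η ≤ 0 := by
    have h1 := hk.sub_dotProduct_sub_eq (P *ᵥ b)
    have h2 := dotProduct_diffMatrix_nonneg hk.nonneg hPb
    have h3 := dotProduct_self_nonneg' (x - P *ᵥ b)
    rw [← neg_sub x, dotProduct_neg] at h1
    by_contra! h
    have := mul_pos h (sub_pos.mpr hw)
    linarith
  have hPx : P *ᵥ (Pᵀ *ᵥ x) = x := by
    rw [Matrix.mulVec_mulVec, hPs.mul_transpose_self, Matrix.one_mulVec]
  have hfeas : owlNorm lam (Pᵀ *ᵥ x) ≤ τ := by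
    have h : absSortDesc (Pᵀ *ᵥ x) = x := by
      rw [hPs.absSortDesc_eq (by rw [hPx]; exact hk.mem), hPx]
    change lam ⬝ᵥ absSortDesc (Pᵀ *ᵥ x) ≤ τ
    rw [h, hk.eq]
  have hmin : ∀ u, owlNorm lam u ≤ τ → halfSqDist b (Pᵀ *ᵥ x) ≤ halfSqDist b u := by
    intro u hu
    refine le_trans ?_ (halfSqDist_absSortDesc_le hP u)
    rw [← hPs.halfSqDist_mulVec, hPx, halfSqDist_expand _ x (absSortDesc u),
      hk.sub_dotProduct_sub_eq]
    have h1 := dotProduct_diffMatrix_nonneg hk.nonneg (absSortDesc_mem_monotoneCone u)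
    have h2 := dotProduct_self_nonneg' (absSortDesc u - x)
    have h3 : 0 ≤ η * (lam ⬝ᵥ absSortDesc u - τ) :=
      mul_nonneg_of_nonpos_of_nonpos hη (sub_nonpos.mpr hu)
    linarith
  refine argminOn_eq hfeas fun z hz hle => ?_
  have h := hmin _ (owlNorm_midpoint_le hlam hz hfeas)
  rw [halfSqDist_expand b (Pᵀ *ᵥ x) (Pᵀ *ᵥ x + _), add_sub_cancel_left, dotProduct_smul,
    dotProduct_smul, smul_dotProduct] at h
  rw [halfSqDist_expand b (Pᵀ *ᵥ x) z] at hle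
  simp only [smul_eq_mul] at h
  exact eq_of_sub_dotProduct_self_nonpos (by linarith)

theorem eventually_sortingPerms_subset {n : ℕ} (b : Fin n → ℝ) :
    ∀ᶠ b' in 𝓝 b, sortingPerms b' ⊆ sortingPerms b := by
  have h : ∀ᶠ b' in 𝓝 b, ∀ P ∈ {P | IsSignedPerm (n := n) P},
      P *ᵥ b ∉ monotoneCone n → P *ᵥ b' ∉ monotoneCone n :=
    (eventually_all_finite (setOf_isSignedPerm_finite n)).mpr fun P _ =>
      eventually_imp_distrib_left.mpr fun hP =>
        (continuous_const.matrix_mulVec continuous_id).continuousAt.eventually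
          ((isClosed_monotoneCone n).isOpen_compl.mem_nhds hP)
  filter_upwards [h] with b' h P hP
  rw [mem_sortingPerms_iff] at *
  exact ⟨hP.1, by_contra fun hn => h P hP.1 hn hP.2⟩

/-! ### Kernel projectors and rank of the stacked matrix -/

/-- The orthogonal projector onto the kernel of a matrix with linearly independent rows. -/
noncomputable def kerProj {m n : Type*} [Fintype m] [DecidableEq m] [Fintype n] [DecidableEq n]
    (A : Matrix m n ℝ) : Matrix n n ℝ :=
  1 - Aᵀ * (A * Aᵀ)⁻¹ * A

section kerProj

variable {m n : Type*} [Fintype m] [DecidableEq m] [Fintype n] [DecidableEq n]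
  {A : Matrix m n ℝ}

theorem kerProj_isSymm (A : Matrix m n ℝ) : (kerProj A).IsSymm := by
  simp only [Matrix.IsSymm, kerProj, Matrix.transpose_sub, Matrix.transpose_one,
    Matrix.transpose_mul, Matrix.transpose_nonsing_inv, Matrix.transpose_transpose,
    Matrix.mul_assoc]

theorem kerProj_mulVec_of_mulVec_eq_zero {u : n → ℝ} (hu : A *ᵥ u = 0) :
    kerProj A *ᵥ u = u := by
  rw [kerProj, Matrix.sub_mulVec, Matrix.one_mulVec, ← Matrix.mulVec_mulVec, hu,
    Matrix.mulVec_zero, sub_zero]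

theorem kerProj_mul_transpose (hA : IsUnit (A * Aᵀ).det) : kerProj A * Aᵀ = 0 := by
  rw [kerProj, Matrix.sub_mul, Matrix.one_mul, Matrix.mul_assoc, Matrix.mul_assoc,
    Matrix.nonsing_inv_mul _ hA, Matrix.mul_one, sub_self]

theorem kerProj_mul_self (hA : IsUnit (A * Aᵀ).det) : kerProj A * kerProj A = kerProj A := by
  have h : kerProj A * (1 - Aᵀ * (A * Aᵀ)⁻¹ * A) = kerProj A := by
    rw [Matrix.mul_sub, Matrix.mul_one, Matrix.mul_assoc, ← Matrix.mul_assoc,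
      kerProj_mul_transpose hA, Matrix.zero_mul, sub_zero]
  exact h

end kerProj

theorem stackedMatrix_mulVec {n : ℕ} (lam : Fin n → ℝ) (Γ : Finset (Fin n)) (u : Fin n → ℝ) :
    stackedMatrix lam Γ *ᵥ u =
      Sum.elim (fun _ => lam ⬝ᵥ u) (fun i : Γ => (diffMatrix n *ᵥ u) i) := by
  funext s
  cases s <;> rfl

theorem stackedMatrix_transpose_mulVec {n : ℕ} (lam : Fin n → ℝ) (Γ : Finset (Fin n)) (η : ℝ)
    {y : Fin n → ℝ} (hy : ∀ i, y i ≠ 0 → i ∈ Γ) :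
    (stackedMatrix lam Γ)ᵀ *ᵥ (Sum.elim (fun _ => η) (fun i : Γ => y i)) =
      η • lam + (diffMatrix n)ᵀ *ᵥ y := by
  refine dotProduct_eq _ _ fun u => ?_
  rw [smul_add_transpose_mulVec_dotProduct, Matrix.mulVec_transpose, ← Matrix.dotProduct_mulVec,
    stackedMatrix_mulVec, dotProduct, Fintype.sum_sum_type]
  simp only [Sum.elim_inl, Sum.elim_inr]
  congr 1
  · rw [Fintype.sum_unique]
  · rw [dotProduct, Finset.sum_coe_sort Γ fun i => y i * (diffMatrix n *ᵥ u) i]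
    refine Finset.sum_subset (Finset.subset_univ _) fun i _ hi => ?_
    rw [by_contra fun h => hi (hy i h), zero_mul]

/-- The rows are independent: pairing a vanishing combination with `x` isolates the coefficient of
`lam`, and pairing it with the columns of `B⁻¹` isolates the others. -/
theorem isUnit_det_stackedMatrix {n : ℕ} {lam x : Fin n → ℝ} {Γ : Finset (Fin n)}
    (hx : lam ⬝ᵥ x ≠ 0) (hΓ : ∀ i ∈ Γ, (diffMatrix n *ᵥ x) i = 0) :
    IsUnit (stackedMatrix lam Γ * (stackedMatrix lam Γ)ᵀ).det := by
  rw [← Matrix.isUnit_iff_isUnit_det, ← Matrix.mulVec_injective_iff_isUnit,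
    ← Matrix.coe_mulVecLin, injective_iff_map_eq_zero]
  intro c hc
  have hc' : (stackedMatrix lam Γ)ᵀ *ᵥ c = 0 :=
    (Matrix.self_mul_conjTranspose_mulVec_eq_zero (stackedMatrix lam Γ) c).mp hc
  have h : ∀ u, c ⬝ᵥ (stackedMatrix lam Γ *ᵥ u) = 0 := fun u => by
    rw [Matrix.dotProduct_mulVec, ← Matrix.mulVec_transpose, hc', zero_dotProduct]
  have h' : ∀ u, c (Sum.inl ()) * (lam ⬝ᵥ u) +
      ∑ i : Γ, c (Sum.inr i) * (diffMatrix n *ᵥ u) i = 0 := fun u => by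
    have := h u
    rwa [stackedMatrix_mulVec, dotProduct, Fintype.sum_sum_type, Fintype.sum_unique] at this
  have h0 : c (Sum.inl ()) = 0 := by
    have := h' x
    rw [Finset.sum_eq_zero fun i _ => by rw [hΓ i i.2, mul_zero], add_zero] at this
    exact (mul_eq_zero.mp this).resolve_right hx
  funext s
  rcases s with _ | k
  · exact h0
  · have := h' ((prefixMatrix n).col k)
    have hu : ∀ i, (diffMatrix n *ᵥ (prefixMatrix n).col k) i = if i = (k : Fin n) then 1 else 0 :=
      fun i => by
        have h : (diffMatrix n *ᵥ (prefixMatrix n).col k) i =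
          (diffMatrix n * prefixMatrix n) i k := rfl
        rw [h, diffMatrix_mul_prefixMatrix, Matrix.one_apply]
    rw [h0, zero_mul, zero_add, Finset.sum_eq_single k] at this
    · simpa [hu] using this
    · intro i _ hi
      rw [hu, if_neg fun h => hi (Subtype.ext h), mul_zero]
    · simp

/-! ### The generalized Jacobian -/

section genJacobian

variable {n : ℕ} {lam : Fin n → ℝ} {τ : ℝ}

theorem isUnit_det_of_mem_indexFamily (hlam : lam ∈ monotoneCone n) (hne : lam ≠ 0) (hτ : 0 < τ)
    {w : Fin n → ℝ} {Γ : Finset (Fin n)} (hΓ : Γ ∈ indexFamily lam τ w) :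
    IsUnit (stackedMatrix lam Γ * (stackedMatrix lam Γ)ᵀ).det :=
  isUnit_det_stackedMatrix (by rw [(isKKT_xLam hlam hne hτ w).eq]; exact hτ.ne') hΓ.2

theorem kerProj_mulVec_xLam_sub (hlam : lam ∈ monotoneCone n) (hne : lam ≠ 0) (hτ : 0 < τ)
    {w : Fin n → ℝ} {Γ : Finset (Fin n)} (hΓ : Γ ∈ indexFamily lam τ w) :
    kerProj (stackedMatrix lam Γ) *ᵥ (xLam lam τ w - w) = 0 := by
  rw [(isKKT_xLam hlam hne hτ w).stat, ← stackedMatrix_transpose_mulVec lam Γ _ hΓ.1,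
    Matrix.mulVec_mulVec, kerProj_mul_transpose (isUnit_det_of_mem_indexFamily hlam hne hτ hΓ),
    Matrix.zero_mulVec]

theorem xLam_sub_xLam (hlam : lam ∈ monotoneCone n) (hne : lam ≠ 0) (hτ : 0 < τ)
    {w w' : Fin n → ℝ} {Γ : Finset (Fin n)} (hΓ : Γ ∈ indexFamily lam τ w)
    (hΓ' : Γ ∈ indexFamily lam τ w') :
    xLam lam τ w' - xLam lam τ w = kerProj (stackedMatrix lam Γ) *ᵥ (w' - w) := by
  have h1 := kerProj_mulVec_xLam_sub hlam hne hτ hΓ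
  have h2 := kerProj_mulVec_xLam_sub hlam hne hτ hΓ'
  have h3 : stackedMatrix lam Γ *ᵥ (xLam lam τ w' - xLam lam τ w) = 0 := by
    rw [stackedMatrix_mulVec, dotProduct_sub, (isKKT_xLam hlam hne hτ w).eq,
      (isKKT_xLam hlam hne hτ w').eq, sub_self, Matrix.mulVec_sub]
    funext s
    rcases s with _ | i
    · rfl
    · simp [hΓ.2 i i.2, hΓ'.2 i i.2]
  rw [← kerProj_mulVec_of_mulVec_eq_zero h3]
  rw [Matrix.mulVec_sub, sub_eq_zero] at h1 h2
  rw [Matrix.mulVec_sub, Matrix.mulVec_sub, h1, h2]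

theorem mem_genJacobian_iff {b : Fin n → ℝ} {S : Matrix (Fin n) (Fin n) ℝ} :
    S ∈ genJacobian lam τ b ↔ ∃ P ∈ sortingPerms b, ∃ Γ ∈ indexFamily lam τ (P *ᵥ b),
      S = Pᵀ * kerProj (stackedMatrix lam Γ) * P := by
  constructor
  · rintro ⟨P, hP, V, ⟨Γ, hΓ, rfl⟩, rfl⟩
    exact ⟨P, hP, Γ, hΓ, rfl⟩
  · rintro ⟨P, hP, Γ, hΓ, rfl⟩
    exact ⟨P, hP, _, ⟨Γ, hΓ, rfl⟩, rfl⟩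

theorem genJacobian_nonempty (hlam : lam ∈ monotoneCone n) (hne : lam ≠ 0) (hτ : 0 < τ)
    (b : Fin n → ℝ) : (genJacobian lam τ b).Nonempty := by
  obtain ⟨P, hP⟩ := sortingPerms_nonempty b
  obtain ⟨Γ, hΓ⟩ := indexFamily_nonempty hlam hne hτ (P *ᵥ b)
  exact ⟨_, mem_genJacobian_iff.mpr ⟨P, hP, Γ, hΓ, rfl⟩⟩

theorem genJacobian_finite (lam : Fin n → ℝ) (τ : ℝ) (b : Fin n → ℝ) :
    (genJacobian lam τ b).Finite := by
  refine (Set.Finite.image2 (fun (P : Matrix (Fin n) (Fin n) ℝ) (Γ : Finset (Fin n)) =>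
    Pᵀ * kerProj (stackedMatrix lam Γ) * P) (setOf_isSignedPerm_finite n)
    Set.finite_univ).subset fun S hS => ?_
  obtain ⟨P, hP, Γ, -, rfl⟩ := mem_genJacobian_iff.mp hS
  exact ⟨P, hP.1, Γ, Set.mem_univ _, rfl⟩

theorem posSemidef_of_mem_genJacobian (hlam : lam ∈ monotoneCone n) (hne : lam ≠ 0) (hτ : 0 < τ)
    {b : Fin n → ℝ} {S : Matrix (Fin n) (Fin n) ℝ} (hS : S ∈ genJacobian lam τ b) :
    S.PosSemidef := by
  obtain ⟨P, hP, Γ, hΓ, rfl⟩ := mem_genJacobian_iff.mp hS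
  -- The projector `K` is symmetric and idempotent, so `Pᵀ K P = (K P)ᵀ (K P)`.
  have h := Matrix.posSemidef_conjTranspose_mul_self (kerProj (stackedMatrix lam Γ) * P)
  rwa [Matrix.conjTranspose_eq_transpose_of_trivial, Matrix.transpose_mul,
    (kerProj_isSymm (stackedMatrix lam Γ)).eq, Matrix.mul_assoc, ← Matrix.mul_assoc (kerProj _),
    kerProj_mul_self (isUnit_det_of_mem_indexFamily hlam hne hτ hΓ), ← Matrix.mul_assoc] at h

theorem eventually_genJacobian (hlam : lam ∈ monotoneCone n) (hne : lam ≠ 0) (hτ : 0 < τ)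
    (b : Fin n → ℝ) : ∀ᶠ b' in 𝓝 b, genJacobian lam τ b' ⊆ genJacobian lam τ b ∧
      (τ < owlNorm lam b → ∀ S ∈ genJacobian lam τ b',
        owlProj lam τ b' - owlProj lam τ b - S *ᵥ (b' - b) = 0) := by
  have hidx : ∀ᶠ b' in 𝓝 b, ∀ P ∈ {P | IsSignedPerm (n := n) P},
      indexFamily lam τ (P *ᵥ b') ⊆ indexFamily lam τ (P *ᵥ b) :=
    (eventually_all_finite (setOf_isSignedPerm_finite n)).mpr fun P _ =>
      (continuous_const.matrix_mulVec continuous_id).continuousAt.eventually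
        (eventually_indexFamily_subset hlam hne hτ (P *ᵥ b))
  have hgt : ∀ᶠ b' in 𝓝 b, ∀ P ∈ {P | IsSignedPerm (n := n) P},
      τ < lam ⬝ᵥ (P *ᵥ b) → τ < lam ⬝ᵥ (P *ᵥ b') :=
    (eventually_all_finite (setOf_isSignedPerm_finite n)).mpr fun P _ =>
      eventually_imp_distrib_left.mpr fun hP =>
        (continuous_const.dotProduct
          (continuous_const.matrix_mulVec continuous_id)).continuousAt.eventually_const_lt hP
  filter_upwards [eventually_sortingPerms_subset b, hidx, hgt] with b' hsort hidx hgt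
  refine ⟨fun S hS => ?_, fun hb S hS => ?_⟩
  · obtain ⟨P, hP, Γ, hΓ, rfl⟩ := mem_genJacobian_iff.mp hS
    exact mem_genJacobian_iff.mpr ⟨P, hsort hP, Γ, hidx P hP.1 hΓ, rfl⟩
  · obtain ⟨P, hP, Γ, hΓ, rfl⟩ := mem_genJacobian_iff.mp hS
    have hb' : τ < owlNorm lam b' := by
      have h := hgt P hP.1 (by rw [(hsort hP).2]; exact hb)
      rw [hP.2] at h
      exact h
    rw [owlProj_eq hlam hne hτ hb (hsort hP), owlProj_eq hlam hne hτ hb' hP, ← Matrix.mulVec_sub,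
      xLam_sub_xLam hlam hne hτ (hidx P hP.1 hΓ) hΓ, ← Matrix.mulVec_sub, Matrix.mulVec_mulVec,
      Matrix.mulVec_mulVec, sub_self]

end genJacobian

/-! ### Jacobians and the B-subdifferential -/

/-- If increments of `F` at `x` are given by matrices from a finite set, then the Jacobian of `F`
at `x`, if it exists, belongs to that set. -/
theorem toMatrix_fderiv_mem_of_finite {n : ℕ} {F : (Fin n → ℝ) → (Fin n → ℝ)} {x : Fin n → ℝ}
    {T : Set (Matrix (Fin n) (Fin n) ℝ)} (hT : T.Finite) (hF : DifferentiableAt ℝ F x)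
    (h : ∀ᶠ z in 𝓝 x, ∃ S ∈ T, F z - F x = S *ᵥ (z - x)) :
    LinearMap.toMatrix' (fderiv ℝ F x : (Fin n → ℝ) →ₗ[ℝ] (Fin n → ℝ)) ∈ T := by
  classical
  set J := LinearMap.toMatrix' (fderiv ℝ F x : (Fin n → ℝ) →ₗ[ℝ] (Fin n → ℝ)) with hJ
  have hJv : ∀ v, fderiv ℝ F x v = J *ᵥ v := fun v => by
    rw [hJ, LinearMap.toMatrix'_mulVec]; rfl
  have hdir : ∀ v, ∃ S ∈ T, J *ᵥ v = S *ᵥ v := by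
    intro v
    -- Difference quotients along `v` take values in this finite set, so their limit does too.
    have hcl : IsClosed ((fun S => S *ᵥ v) '' T) := (hT.image _).isClosed
    have hlim := (hF.hasFDerivAt.hasLineDerivAt v).tendsto_slope_zero
    have hmap : Tendsto (fun t : ℝ => x + t • v) (𝓝[≠] 0) (𝓝 x) := by
      have hc : Continuous fun t : ℝ => x + t • v := by fun_prop
      have := hc.tendsto 0
      rw [zero_smul, add_zero] at this
      exact this.mono_left nhdsWithin_le_nhds
    have hev : ∀ᶠ t in 𝓝[≠] (0 : ℝ),
        t⁻¹ • (F (x + t • v) - F x) ∈ (fun S => S *ᵥ v) '' T := by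
      filter_upwards [hmap.eventually h, self_mem_nhdsWithin] with t ht ht0
      obtain ⟨S, hS, hSt⟩ := ht
      refine ⟨S, hS, ?_⟩
      rw [hSt, add_sub_cancel_left, Matrix.mulVec_smul, smul_smul, inv_mul_cancel₀ ht0, one_smul]
    obtain ⟨S, hS, hSv⟩ := hcl.mem_of_tendsto hlim hev
    exact ⟨S, hS, by rw [← hJv, ← hSv]⟩
  by_contra hnot
  -- The kernels of `J - S` cover the space, yet none is everything if `J ∉ T`.
  refine Subspace.biUnion_ne_univ_of_top_notMem
    (s := hT.toFinset.image fun S => LinearMap.ker (J - S).mulVecLin) ?_ ?_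
  · simp only [Finset.mem_image, Set.Finite.mem_toFinset, not_exists, not_and]
    intro S hS htop
    refine hnot ?_
    have hJS : J = S := Matrix.ext_of_mulVec_single fun i => by
      have : Pi.single i 1 ∈ LinearMap.ker (J - S).mulVecLin := by rw [htop]; trivial
      rwa [LinearMap.mem_ker, Matrix.mulVecLin_apply, Matrix.sub_mulVec, sub_eq_zero] at this
    exact hJS ▸ hS
  · refine Set.eq_univ_of_forall fun v => ?_
    obtain ⟨S, hS, hSv⟩ := hdir v
    simp only [Set.mem_iUnion]
    refine ⟨_, Finset.mem_image_of_mem _ (hT.mem_toFinset.mpr hS), ?_⟩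
    rw [SetLike.mem_coe, LinearMap.mem_ker, Matrix.mulVecLin_apply, Matrix.sub_mulVec, hSv,
      sub_self]

theorem bSubdifferential_owlProj_subset {n : ℕ} {lam : Fin n → ℝ} (hlam : lam ∈ monotoneCone n)
    (hne : lam ≠ 0) {τ : ℝ} (hτ : 0 < τ) {b : Fin n → ℝ} (hb : τ < owlNorm lam b) :
    bSubdifferential (owlProj lam τ) b ⊆ genJacobian lam τ b := by
  rintro V ⟨u, hdiff, hu, hV⟩
  refine (genJacobian_finite lam τ b).isClosed.mem_of_tendsto hV ?_
  have hgt : ∀ᶠ b' in 𝓝 b, τ < owlNorm lam b' := by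
    obtain ⟨P, hP⟩ := sortingPerms_nonempty b
    have hb' : τ < lam ⬝ᵥ (P *ᵥ b) := by rw [hP.2]; exact hb
    have h := (continuous_const.dotProduct
      (continuous_const.matrix_mulVec continuous_id)).continuousAt.eventually_const_lt hb'
    filter_upwards [h] with b' h
    -- For the fixed `P`, the linear functional `⟨lam, P b'⟩` bounds the norm from below, so
    -- continuity of the norm is not needed.
    exact h.trans_le (hP.1.dotProduct_mulVec_le hlam b')
  filter_upwards [hu.eventually (eventually_genJacobian hlam hne hτ b), hu.eventually hgt]
    with k hk hgt
  refine hk.1 (toMatrix_fderiv_mem_of_finite (genJacobian_finite lam τ (u k)) (hdiff k) ?_)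
  filter_upwards [eventually_genJacobian hlam hne hτ (u k)] with z hz
  obtain ⟨S, hS⟩ := genJacobian_nonempty hlam hne hτ z
  exact ⟨S, hz.1 hS, sub_eq_zero.mp (hz.2 hgt S hS)⟩

theorem mainTheorem3 {n : ℕ} (lam : Fin n → ℝ) (hlam : lam ∈ monotoneCone n) (hne : lam ≠ 0)
    (τ : ℝ) (hτ : 0 < τ) :
    (∀ b, (genJacobian lam τ b).Nonempty ∧ IsCompact (genJacobian lam τ b)) ∧
    UpperHemicontinuous (genJacobian lam τ) ∧
    (∀ b, ∀ S ∈ genJacobian lam τ b, S.IsSymm ∧ S.PosSemidef) ∧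
    (∀ b, ∃ W ∈ 𝓝 b, ∀ b' ∈ W, genJacobian lam τ b' ⊆ genJacobian lam τ b ∧
      (τ < owlNorm lam b → ∀ S ∈ genJacobian lam τ b',
        owlProj lam τ b' - owlProj lam τ b - S *ᵥ (b' - b) = 0)) ∧
    (∀ b, τ < owlNorm lam b →
      bSubdifferential (owlProj lam τ) b ⊆ genJacobian lam τ b) := by
  refine ⟨fun b => ⟨genJacobian_nonempty hlam hne hτ b, (genJacobian_finite lam τ b).isCompact⟩,
    fun b t ht => ?_, fun b S hS => ?_, fun b => ?_,
    fun b hb => bSubdifferential_owlProj_subset hlam hne hτ hb⟩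
  · filter_upwards [eventually_genJacobian hlam hne hτ b] with b' hb'
    exact nhdsSet_mono hb'.1 ht
  · have h := posSemidef_of_mem_genJacobian hlam hne hτ hS
    exact ⟨by simpa using h.isHermitian, h⟩
  · exact ⟨_, eventually_genJacobian hlam hne hτ b, fun b' hb' => hb'⟩
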